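/- Let $A,B,C>0$, let $Q=(0,\infty)\times(0,\infty)$ and $S=\{(x,t): x\ge 0,\ t\ge 0\}\setminus\{(0,0)\}$, and let $f$, $u_0$, $g_0$ be given complex-valued functions (on $Q$, $(0,\infty)$, $(0,\infty)$ respectively). Consider the oblique Robin problem for the heat equation on the quarter-plane $$u_t=u_{xx}+f \ \text{ in } Q,\qquad u(x,0)=u_0(x)\ (x>0),\qquad Au(0,t)+Bu_x(0,t)+Cu_t(0,t)=g_0(t)\ (t>0). \tag{R}$$ Call a function $V$ on $S$ *admissible* if 1. for every $t>0$, $\lim_{x\to\infty}V(x,t)=0$ and $\sup_{x\ge1}|V_x(x,t)|<\infty$; and 2. for every $T>0$ there is an integrable function $M_T$ on $(0,\infty)$ such that $|V(x,t)|^2\le M_T(x)$ and $|V_t(x,t)|^2\le M_T(x)$ for all $x>0$ and $0<t\le T$. Let $u$ and $v$ be two solutions of (R), of class $C^3$ on $S$ (up to the boundary), such that $Au+Bu_x+Cu_t$ and $Av+Bv_x+Cv_t$ are admissible. Put $\xi=v-u$ and $w=A\xi+B\xi_x+C\xi_t$. Then: - $w$ is of class $C^2$ on $S$, is admissible, and solves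 the homogeneous Dirichlet problem $w_t=w_{xx}$ in $Q$, $w(x,0)=0$ for $x>0$, $w(0,t)=0$ for $t>0$; - $w\equiv0$ on $S$; - $\xi\equiv0$, that is, $v\equiv u$, on $S$. -/

import Mathlib

open Set Filter Topology MeasureTheory

namespace QuarterPlane

noncomputable section

/-- The closed quarter-plane `{x ≥ 0, t ≥ 0}` without its corner `(0, 0)`. -/
def puncturedQuadrant : Set (ℝ × ℝ) :=
  {p | 0 ≤ p.1 ∧ 0 ≤ p.2 ∧ p ≠ (0, 0)}

/-- `V` is of class `C^n` on the closed quarter-plane without its corner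
(up to the boundary, with one-sided derivatives there). -/
def IsCn (n : ℕ) (V : ℝ → ℝ → ℂ) : Prop :=
  ContDiffOn ℝ n (fun p : ℝ × ℝ => V p.1 p.2) puncturedQuadrant

/-- The partial derivative `V_x` (the right derivative at `x = 0`). -/
def dx (V : ℝ → ℝ → ℂ) : ℝ → ℝ → ℂ :=
  fun x t => derivWithin (fun y => V y t) (Ici 0) x

/-- The partial derivative `V_t` (the right derivative at `t = 0`). -/
def dt (V : ℝ → ℝ → ℂ) : ℝ → ℝ → ℂ :=
  fun x t => derivWithin (fun s => V x s) (Ici 0) t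

/-- The oblique Robin expression `A V + B V_x + C V_t`. -/
def robin (A B C : ℝ) (V : ℝ → ℝ → ℂ) : ℝ → ℝ → ℂ :=
  fun x t => (A : ℂ) * V x t + (B : ℂ) * dx V x t + (C : ℂ) * dt V x t

/-- `V_t = V_xx + f` on the open quarter-plane. -/
def SolvesHeat (f V : ℝ → ℝ → ℂ) : Prop :=
  ∀ x t : ℝ, 0 < x → 0 < t → dt V x t = dx (dx V) x t + f x t

/-- `V` is a `C^2` solution (up to the boundary, without the corner) of the heat equation with
forcing `f`, initial data `u₀` and Dirichlet data `g₀`. -/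
structure IsDirichletSolution (f : ℝ → ℝ → ℂ) (u₀ g₀ : ℝ → ℂ) (V : ℝ → ℝ → ℂ) : Prop where
  smooth : IsCn 2 V
  heat : SolvesHeat f V
  initial : ∀ x : ℝ, 0 < x → V x 0 = u₀ x
  boundary : ∀ t : ℝ, 0 < t → V 0 t = g₀ t

/-- `V` is a `C^3` solution (up to the boundary, without the corner) of the heat equation with
forcing `f`, initial data `u₀` and oblique Robin data
`A V(0,t) + B V_x(0,t) + C V_t(0,t) = g₀(t)`. -/
structure IsRobinSolution (A B C : ℝ) (f : ℝ → ℝ → ℂ) (u₀ g₀ : ℝ → ℂ) (V : ℝ → ℝ → ℂ) :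
    Prop where
  smooth : IsCn 3 V
  heat : SolvesHeat f V
  initial : ∀ x : ℝ, 0 < x → V x 0 = u₀ x
  boundary : ∀ t : ℝ, 0 < t → robin A B C V 0 t = g₀ t

/-- The conditions at infinity and near `t = 0` under which the Dirichlet problem has at most one
solution: for each `t > 0`, `V(x,t) → 0` as `x → ∞` and `V_x(·,t)` is bounded on `[1, ∞)`; and
for each `T > 0`, `|V|^2` and `|V_t|^2` are dominated on `0 < t ≤ T` by one integrable
function of `x > 0`. -/
structure IsAdmissible (V : ℝ → ℝ → ℂ) : Prop where
  tendsto_zero : ∀ t : ℝ, 0 < t → Tendsto (fun x => V x t) atTop (𝓝 0)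
  bounded_dx : ∀ t : ℝ, 0 < t → ∃ K : ℝ, ∀ x : ℝ, 1 ≤ x → ‖dx V x t‖ ≤ K
  dominated : ∀ T : ℝ, 0 < T → ∃ M : ℝ → ℝ, IntegrableOn M (Ioi 0) ∧
    ∀ x t : ℝ, 0 < x → 0 < t → t ≤ T → ‖V x t‖ ^ 2 ≤ M x ∧ ‖dt V x t‖ ^ 2 ≤ M x

end

end QuarterPlane

namespace QuarterPlane

lemma convex_puncturedQuadrant : Convex ℝ puncturedQuadrant := by
  rintro ⟨x, t⟩ ⟨hx, ht, h⟩ ⟨y, s⟩ ⟨hy, hs, h'⟩ a b ha hb hab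
  simp only [ne_eq, Prod.mk.injEq, not_and_or] at h h' hx ht hy hs
  refine ⟨?_, ?_, ?_⟩
  · simp only [Prod.smul_mk, Prod.mk_add_mk, smul_eq_mul]; positivity
  · simp only [Prod.smul_mk, Prod.mk_add_mk, smul_eq_mul]; positivity
  · have hxt : 0 < x + t := by
      rcases h with h | h
      · linarith [lt_of_le_of_ne hx (Ne.symm h)]
      · linarith [lt_of_le_of_ne ht (Ne.symm h)]
    have hys : 0 < y + s := by
      rcases h' with h | h
      · linarith [lt_of_le_of_ne hy (Ne.symm h)]
      · linarith [lt_of_le_of_ne hs (Ne.symm h)]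
    intro he
    simp only [Prod.smul_mk, Prod.mk_add_mk, smul_eq_mul, Prod.mk.injEq] at he
    have h0 : a * (x + t) + b * (y + s) = 0 := by linarith [he.1, he.2]
    have h1 := mul_nonneg ha hxt.le
    have h2 := mul_nonneg hb hys.le
    have ha0 : a = 0 := by
      rcases mul_eq_zero.1 (show a * (x + t) = 0 by linarith) with h | h
      · exact h
      · linarith
    have hb0 : b = 0 := by
      rcases mul_eq_zero.1 (show b * (y + s) = 0 by linarith) with h | h
      · exact h
      · linarith
    linarith

lemma mem_interior_puncturedQuadrant {x t : ℝ} (hx : 0 < x) (ht : 0 < t) :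
    (x, t) ∈ interior puncturedQuadrant := by
  refine mem_interior.2 ⟨Ioi 0 ×ˢ Ioi 0, ?_, isOpen_Ioi.prod isOpen_Ioi, hx, ht⟩
  rintro ⟨y, s⟩ ⟨hy, hs⟩
  simp only [mem_Ioi] at hy hs
  exact ⟨hy.le, hs.le, fun h => hy.ne' (Prod.ext_iff.1 h).1⟩

lemma uniqueDiffOn_puncturedQuadrant : UniqueDiffOn ℝ puncturedQuadrant :=
  uniqueDiffOn_convex convex_puncturedQuadrant
    ⟨_, mem_interior_puncturedQuadrant one_pos one_pos⟩

lemma subset_closure_interior_puncturedQuadrant :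
    puncturedQuadrant ⊆ closure (interior puncturedQuadrant) := by
  rw [convex_puncturedQuadrant.closure_interior_eq_closure_of_nonempty_interior
    ⟨_, mem_interior_puncturedQuadrant one_pos one_pos⟩]
  exact subset_closure

lemma mem_puncturedQuadrant_of_pos_left {x t : ℝ} (hx : 0 < x) (ht : 0 ≤ t) :
    (x, t) ∈ puncturedQuadrant :=
  ⟨hx.le, ht, fun h => hx.ne' (Prod.ext_iff.1 h).1⟩

lemma mem_puncturedQuadrant_of_pos_right {x t : ℝ} (hx : 0 ≤ x) (ht : 0 < t) :
    (x, t) ∈ puncturedQuadrant :=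
  ⟨hx, ht.le, fun h => ht.ne' (Prod.ext_iff.1 h).2⟩

lemma pos_or_pos_of_mem {x t : ℝ} (h : (x, t) ∈ puncturedQuadrant) : 0 < x ∨ 0 < t := by
  obtain ⟨hx, ht, h⟩ := h
  by_contra! hc
  exact h (Prod.ext (le_antisymm hc.1 hx) (le_antisymm hc.2 ht))

lemma horizontal_slice_mem_nhdsWithin {x t : ℝ} (h : (x, t) ∈ puncturedQuadrant) :
    {y | (y, t) ∈ puncturedQuadrant} ∈ 𝓝[Ici 0] x := by
  rcases pos_or_pos_of_mem h with hx | ht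
  · exact mem_nhdsWithin_of_mem_nhds (mem_of_superset (Ioi_mem_nhds hx)
      fun y hy => mem_puncturedQuadrant_of_pos_left hy h.2.1)
  · exact mem_of_superset self_mem_nhdsWithin
      fun y hy => mem_puncturedQuadrant_of_pos_right hy ht

lemma vertical_slice_mem_nhdsWithin {x t : ℝ} (h : (x, t) ∈ puncturedQuadrant) :
    {s | (x, s) ∈ puncturedQuadrant} ∈ 𝓝[Ici 0] t := by
  rcases pos_or_pos_of_mem h with hx | ht
  · exact mem_of_superset self_mem_nhdsWithin
      fun y hy => mem_puncturedQuadrant_of_pos_left hx hy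
  · exact mem_nhdsWithin_of_mem_nhds (mem_of_superset (Ioi_mem_nhds ht)
      fun y hy => mem_puncturedQuadrant_of_pos_right h.1 hy)

variable {V W : ℝ → ℝ → ℂ} {x t : ℝ} {n : ℕ}

lemma IsCn.of_le {m : ℕ} (hV : IsCn n V) (h : m ≤ n) : IsCn m V :=
  ContDiffOn.of_le hV (by exact_mod_cast h)

lemma IsCn.hasFDerivWithinAt (hV : IsCn 1 V) (h : (x, t) ∈ puncturedQuadrant) :
    HasFDerivWithinAt (fun p : ℝ × ℝ => V p.1 p.2)
      (fderivWithin ℝ (fun p : ℝ × ℝ => V p.1 p.2) puncturedQuadrant (x, t))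
      puncturedQuadrant (x, t) :=
  (ContDiffOn.differentiableOn hV (by simp) _ h).hasFDerivWithinAt

lemma IsCn.hasDerivWithinAt_fst_aux (hV : IsCn 1 V) (h : (x, t) ∈ puncturedQuadrant) :
    HasDerivWithinAt (fun y => V y t)
      (fderivWithin ℝ (fun p : ℝ × ℝ => V p.1 p.2) puncturedQuadrant (x, t) (1, 0))
      (Ici 0) x := by
  have h1 : HasDerivWithinAt (fun y : ℝ => (y, t)) ((1 : ℝ), (0 : ℝ))
      {y | (y, t) ∈ puncturedQuadrant} x :=
    (hasDerivWithinAt_id x _).prodMk (hasDerivWithinAt_const x _ t)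
  exact ((hV.hasFDerivWithinAt h).comp_hasDerivWithinAt x h1 fun y hy => hy).mono_of_mem_nhdsWithin
    (horizontal_slice_mem_nhdsWithin h)

lemma IsCn.hasDerivWithinAt_snd_aux (hV : IsCn 1 V) (h : (x, t) ∈ puncturedQuadrant) :
    HasDerivWithinAt (fun s => V x s)
      (fderivWithin ℝ (fun p : ℝ × ℝ => V p.1 p.2) puncturedQuadrant (x, t) (0, 1))
      (Ici 0) t := by
  have h1 : HasDerivWithinAt (fun s : ℝ => (x, s)) ((0 : ℝ), (1 : ℝ))
      {s | (x, s) ∈ puncturedQuadrant} t :=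
    (hasDerivWithinAt_const t _ x).prodMk (hasDerivWithinAt_id t _)
  exact ((hV.hasFDerivWithinAt h).comp_hasDerivWithinAt t h1 fun y hy => hy).mono_of_mem_nhdsWithin
    (vertical_slice_mem_nhdsWithin h)

lemma IsCn.dx_eq_fderivWithin (hV : IsCn 1 V) (h : (x, t) ∈ puncturedQuadrant) :
    dx V x t =
      fderivWithin ℝ (fun p : ℝ × ℝ => V p.1 p.2) puncturedQuadrant (x, t) (1, 0) :=
  (hV.hasDerivWithinAt_fst_aux h).derivWithin (uniqueDiffOn_Ici 0 x h.1)

lemma IsCn.dt_eq_fderivWithin (hV : IsCn 1 V) (h : (x, t) ∈ puncturedQuadrant) :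
    dt V x t =
      fderivWithin ℝ (fun p : ℝ × ℝ => V p.1 p.2) puncturedQuadrant (x, t) (0, 1) :=
  (hV.hasDerivWithinAt_snd_aux h).derivWithin (uniqueDiffOn_Ici 0 t h.2.1)

lemma IsCn.hasDerivWithinAt_dx (hV : IsCn 1 V) (h : (x, t) ∈ puncturedQuadrant) :
    HasDerivWithinAt (fun y => V y t) (dx V x t) (Ici 0) x :=
  hV.dx_eq_fderivWithin h ▸ hV.hasDerivWithinAt_fst_aux h

lemma IsCn.hasDerivWithinAt_dt (hV : IsCn 1 V) (h : (x, t) ∈ puncturedQuadrant) :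
    HasDerivWithinAt (fun s => V x s) (dt V x t) (Ici 0) t :=
  hV.dt_eq_fderivWithin h ▸ hV.hasDerivWithinAt_snd_aux h

lemma IsCn.hasDerivAt_dx (hV : IsCn 1 V) (hx : 0 < x) (ht : 0 ≤ t) :
    HasDerivAt (fun y => V y t) (dx V x t) x :=
  (hV.hasDerivWithinAt_dx (mem_puncturedQuadrant_of_pos_left hx ht)).hasDerivAt (Ici_mem_nhds hx)

lemma IsCn.hasDerivAt_dt (hV : IsCn 1 V) (hx : 0 ≤ x) (ht : 0 < t) :
    HasDerivAt (fun s => V x s) (dt V x t) t :=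
  (hV.hasDerivWithinAt_dt (mem_puncturedQuadrant_of_pos_right hx ht)).hasDerivAt (Ici_mem_nhds ht)

lemma IsCn.contDiffOn_fderivWithin_apply (hV : IsCn (n + 1) V) (e : ℝ × ℝ) :
    ContDiffOn ℝ n (fun p => fderivWithin ℝ (fun p : ℝ × ℝ => V p.1 p.2) puncturedQuadrant p e)
      puncturedQuadrant :=
  (ContDiffOn.fderivWithin hV uniqueDiffOn_puncturedQuadrant (by norm_cast)).clm_apply
    contDiffOn_const

lemma IsCn.dx (hV : IsCn (n + 1) V) : IsCn n (dx V) :=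
  (hV.contDiffOn_fderivWithin_apply (1, 0)).congr fun _ hp =>
    (hV.of_le (by lia)).dx_eq_fderivWithin hp

lemma IsCn.dt (hV : IsCn (n + 1) V) : IsCn n (dt V) :=
  (hV.contDiffOn_fderivWithin_apply (0, 1)).congr fun _ hp =>
    (hV.of_le (by lia)).dt_eq_fderivWithin hp

lemma IsCn.sub (hV : IsCn n V) (hW : IsCn n W) : IsCn n (fun x t => V x t - W x t) :=
  ContDiffOn.sub hV hW

lemma IsCn.robin (A B C : ℝ) (hV : IsCn (n + 1) V) : IsCn n (robin A B C V) :=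
  ((contDiffOn_const.mul (hV.of_le (by lia))).add (contDiffOn_const.mul hV.dx)).add
    (contDiffOn_const.mul hV.dt)

lemma IsCn.dx_dt_comm (hV : IsCn 2 V) (h : (x, t) ∈ puncturedQuadrant) :
    QuarterPlane.dx (QuarterPlane.dt V) x t = QuarterPlane.dt (QuarterPlane.dx V) x t := by
  have hV1 : IsCn 1 V := hV.of_le (by lia)
  have hs := ContDiffWithinAt.isSymmSndFDerivWithinAt (hV _ h) (by simp)
    uniqueDiffOn_puncturedQuadrant (subset_closure_interior_puncturedQuadrant h) h
  have hd : DifferentiableWithinAt ℝ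
      (fderivWithin ℝ (fun p : ℝ × ℝ => V p.1 p.2) puncturedQuadrant) puncturedQuadrant (x, t) :=
    (ContDiffOn.fderivWithin hV uniqueDiffOn_puncturedQuadrant (m := 1)
      (by norm_num)).differentiableOn (by simp) _ h
  have key (e e' : ℝ × ℝ) : fderivWithin ℝ
      (fun p => fderivWithin ℝ (fun p : ℝ × ℝ => V p.1 p.2) puncturedQuadrant p e)
      puncturedQuadrant (x, t) e' = fderivWithin ℝ
      (fderivWithin ℝ (fun p : ℝ × ℝ => V p.1 p.2) puncturedQuadrant)
      puncturedQuadrant (x, t) e' e := by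
    rw [fderivWithin_clm_apply (uniqueDiffOn_puncturedQuadrant _ h) hd
      (differentiableWithinAt_const e)]
    simp
  rw [IsCn.dx_eq_fderivWithin hV.dt h, IsCn.dt_eq_fderivWithin hV.dx h,
    fderivWithin_congr (fun p hp => hV1.dt_eq_fderivWithin hp) (hV1.dt_eq_fderivWithin h),
    fderivWithin_congr (fun p hp => hV1.dx_eq_fderivWithin hp) (hV1.dx_eq_fderivWithin h),
    key, key]
  exact hs _ _

lemma dx_congr (hVW : ∀ x t, 0 < x → 0 < t → V x t = W x t) (hx : 0 < x) (ht : 0 < t) :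
    dx V x t = dx W x t :=
  EventuallyEq.derivWithin_eq (mem_nhdsWithin_of_mem_nhds
    (mem_of_superset (Ioi_mem_nhds hx) fun y hy => hVW y t hy ht)) (hVW x t hx ht)

lemma dt_congr (hVW : ∀ x t, 0 < x → 0 < t → V x t = W x t) (hx : 0 < x) (ht : 0 < t) :
    dt V x t = dt W x t :=
  EventuallyEq.derivWithin_eq (mem_nhdsWithin_of_mem_nhds
    (mem_of_superset (Ioi_mem_nhds ht) fun s hs => hVW x s hx hs)) (hVW x t hx ht)

lemma robin_congr (A B C : ℝ) (hVW : ∀ x t, 0 < x → 0 < t → V x t = W x t) (hx : 0 < x)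
    (ht : 0 < t) : robin A B C V x t = robin A B C W x t := by
  simp only [robin, dx_congr hVW hx ht, dt_congr hVW hx ht, hVW x t hx ht]

lemma IsCn.dx_robin (A B C : ℝ) (hV : IsCn 2 V) (h : (x, t) ∈ puncturedQuadrant) :
    QuarterPlane.dx (QuarterPlane.robin A B C V) x t =
      QuarterPlane.robin A B C (QuarterPlane.dx V) x t := by
  have h0 := ((((hV.of_le (by lia)).hasDerivWithinAt_dx h).const_mul (A : ℂ)).add
    ((IsCn.hasDerivWithinAt_dx hV.dx h).const_mul (B : ℂ))).add
    ((IsCn.hasDerivWithinAt_dx hV.dt h).const_mul (C : ℂ))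
  rw [hV.dx_dt_comm h] at h0
  exact h0.derivWithin (uniqueDiffOn_Ici 0 x h.1)

lemma IsCn.dt_robin (A B C : ℝ) (hV : IsCn 2 V) (h : (x, t) ∈ puncturedQuadrant) :
    QuarterPlane.dt (QuarterPlane.robin A B C V) x t =
      QuarterPlane.robin A B C (QuarterPlane.dt V) x t := by
  have h0 := ((((hV.of_le (by lia)).hasDerivWithinAt_dt h).const_mul (A : ℂ)).add
    ((IsCn.hasDerivWithinAt_dt hV.dx h).const_mul (B : ℂ))).add
    ((IsCn.hasDerivWithinAt_dt hV.dt h).const_mul (C : ℂ))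
  rw [← hV.dx_dt_comm h] at h0
  exact h0.derivWithin (uniqueDiffOn_Ici 0 t h.2.1)

lemma dx_sub (hV : IsCn 1 V) (hW : IsCn 1 W) (h : (x, t) ∈ puncturedQuadrant) :
    dx (fun x t => V x t - W x t) x t = dx V x t - dx W x t :=
  ((hV.hasDerivWithinAt_dx h).sub (hW.hasDerivWithinAt_dx h)).derivWithin
    (uniqueDiffOn_Ici 0 x h.1)

lemma dt_sub (hV : IsCn 1 V) (hW : IsCn 1 W) (h : (x, t) ∈ puncturedQuadrant) :
    dt (fun x t => V x t - W x t) x t = dt V x t - dt W x t :=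
  ((hV.hasDerivWithinAt_dt h).sub (hW.hasDerivWithinAt_dt h)).derivWithin
    (uniqueDiffOn_Ici 0 t h.2.1)

lemma robin_sub (A B C : ℝ) (hV : IsCn 1 V) (hW : IsCn 1 W) (h : (x, t) ∈ puncturedQuadrant) :
    robin A B C (fun x t => V x t - W x t) x t = robin A B C V x t - robin A B C W x t := by
  simp only [robin, dx_sub hV hW h, dt_sub hV hW h]
  ring

lemma IsCn.continuousOn_horizontal (hV : IsCn n V) (ht : 0 < t) :
    ContinuousOn (fun x => V x t) (Ici 0) :=
  (ContDiffOn.continuousOn hV).comp (f := fun x : ℝ => (x, t)) (by fun_prop)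
    fun _ hx => mem_puncturedQuadrant_of_pos_right hx ht

lemma IsCn.continuousOn_vertical (hV : IsCn n V) (hx : 0 < x) :
    ContinuousOn (fun t => V x t) (Ici 0) :=
  (ContDiffOn.continuousOn hV).comp (f := fun t : ℝ => (x, t)) (by fun_prop)
    fun _ ht => mem_puncturedQuadrant_of_pos_left hx ht

lemma dx_eq_zero {a : ℝ} (h : ∀ y, a < y → V y t = 0) (hx : a < x) :
    dx V x t = 0 := by
  have h1 : (fun y => V y t) =ᶠ[𝓝[Ici 0] x] fun _ => 0 :=
    mem_nhdsWithin_of_mem_nhds (mem_of_superset (Ioi_mem_nhds hx) h)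
  have := h1.derivWithin_eq (h x hx)
  simpa [dx] using this

lemma IsAdmissible.congr (hV : IsAdmissible V)
    (hVW : ∀ x t, 0 < x → 0 < t → W x t = V x t) : IsAdmissible W where
  tendsto_zero t ht := (hV.tendsto_zero t ht).congr'
    ((eventually_gt_atTop 0).mono fun x hx => (hVW x t hx ht).symm)
  bounded_dx t ht := (hV.bounded_dx t ht).imp fun K hK x hx => by
    rw [dx_congr hVW (one_pos.trans_le hx) ht]
    exact hK x hx
  dominated T hT := (hV.dominated T hT).imp fun M hM => ⟨hM.1, fun x t hx ht htT => by
    rw [dt_congr hVW hx ht, hVW x t hx ht]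
    exact hM.2 x t hx ht htT⟩

lemma norm_sub_sq_le_two_mul (a b : ℂ) : ‖a - b‖ ^ 2 ≤ 2 * (‖a‖ ^ 2 + ‖b‖ ^ 2) := by
  have h := norm_sub_le a b
  nlinarith [sq_nonneg (‖a‖ - ‖b‖), norm_nonneg (a - b), norm_nonneg a, norm_nonneg b]

lemma IsAdmissible.sub (hV : IsAdmissible V) (hW : IsAdmissible W) (hV1 : IsCn 1 V)
    (hW1 : IsCn 1 W) : IsAdmissible (fun x t => V x t - W x t) where
  tendsto_zero t ht := by simpa using (hV.tendsto_zero t ht).sub (hW.tendsto_zero t ht)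
  bounded_dx t ht := by
    obtain ⟨K, hK⟩ := hV.bounded_dx t ht
    obtain ⟨L, hL⟩ := hW.bounded_dx t ht
    refine ⟨K + L, fun x hx => ?_⟩
    rw [dx_sub hV1 hW1 (mem_puncturedQuadrant_of_pos_right (by linarith) ht)]
    exact (norm_sub_le _ _).trans (add_le_add (hK x hx) (hL x hx))
  dominated T hT := by
    obtain ⟨M, hM, hM'⟩ := hV.dominated T hT
    obtain ⟨N, hN, hN'⟩ := hW.dominated T hT
    refine ⟨fun x => 2 * (M x + N x), (hM.add hN).const_mul 2, fun x t hx ht htT => ?_⟩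
    rw [dt_sub hV1 hW1 (mem_puncturedQuadrant_of_pos_right hx.le ht)]
    obtain ⟨h1, h2⟩ := hM' x t hx ht htT
    obtain ⟨h3, h4⟩ := hN' x t hx ht htT
    exact ⟨(norm_sub_sq_le_two_mul _ _).trans (by linarith),
      (norm_sub_sq_le_two_mul _ _).trans (by linarith)⟩

/-- The difference of two solutions solves the homogeneous problem. -/
lemma IsRobinSolution.sub {A B C : ℝ} {f : ℝ → ℝ → ℂ} {u₀ g₀ : ℝ → ℂ} {u v : ℝ → ℝ → ℂ}
    (hv : IsRobinSolution A B C f u₀ g₀ v) (hu : IsRobinSolution A B C f u₀ g₀ u) :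
    IsRobinSolution A B C (fun _ _ => 0) (fun _ => 0) (fun _ => 0)
      (fun x t => v x t - u x t) where
  smooth := hv.smooth.sub hu.smooth
  heat x t hx ht := by
    have hS := mem_puncturedQuadrant_of_pos_left hx ht.le
    have hv1 := hv.smooth.of_le (show 1 ≤ 3 by lia)
    have hu1 := hu.smooth.of_le (show 1 ≤ 3 by lia)
    have hv2 : IsCn 1 (dx v) := (hv.smooth.of_le (show 2 ≤ 3 by lia)).dx
    have hu2 : IsCn 1 (dx u) := (hu.smooth.of_le (show 2 ≤ 3 by lia)).dx
    rw [dt_sub hv1 hu1 hS, dx_congr (fun y s hy hs => dx_sub hv1 hu1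
      (mem_puncturedQuadrant_of_pos_left hy hs.le)) hx ht, dx_sub hv2 hu2 hS,
      hv.heat x t hx ht, hu.heat x t hx ht]
    ring
  initial x hx := by rw [hv.initial x hx, hu.initial x hx, sub_self]
  boundary t ht := by
    rw [robin_sub A B C (hv.smooth.of_le (by lia)) (hu.smooth.of_le (by lia))
      (mem_puncturedQuadrant_of_pos_right le_rfl ht), hv.boundary t ht, hu.boundary t ht, sub_self]

/-- The oblique Robin expression of a solution of the homogeneous Robin problem solves the
homogeneous Dirichlet problem. -/
lemma IsRobinSolution.isDirichletSolution_robin {A B C : ℝ}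
    (hV : IsRobinSolution A B C (fun _ _ => 0) (fun _ => 0) (fun _ => 0) V) :
    IsDirichletSolution (fun _ _ => 0) (fun _ => 0) (fun _ => 0) (robin A B C V) where
  smooth := IsCn.robin A B C hV.smooth
  heat x t hx ht := by
    have hS := mem_puncturedQuadrant_of_pos_left hx ht.le
    have hV2 : IsCn 2 V := hV.smooth.of_le (by lia)
    rw [hV2.dt_robin A B C hS, dx_congr (fun y s hy hs => hV2.dx_robin A B C
      (mem_puncturedQuadrant_of_pos_left hy hs.le)) hx ht, IsCn.dx_robin A B C hV.smooth.dx hS,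
      add_zero]
    exact robin_congr A B C (fun y s hy hs => by rw [hV.heat y s hy hs, add_zero]) hx ht
  initial x hx := by
    have h1 : ∀ y, 0 < y → dx V y 0 = 0 := fun y hy => dx_eq_zero hV.initial hy
    have h2 : dx (dx V) x 0 = 0 := dx_eq_zero h1 hx
    have hxx : IsCn 1 (dx (dx V)) := IsCn.dx hV.smooth.dx
    have h3 : Tendsto (fun t => dx (dx V) x t) (𝓝[>] 0) (𝓝 (dx (dx V) x 0)) :=
      ((hxx.continuousOn_vertical hx) 0 self_mem_Ici).mono_left (nhdsWithin_mono _ Ioi_subset_Ici_self)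
    have h4 : Tendsto (fun t => dt V x t) (𝓝[>] 0) (𝓝 (dt V x 0)) :=
      ((hV.smooth.dt.continuousOn_vertical hx) 0 self_mem_Ici).mono_left
        (nhdsWithin_mono _ Ioi_subset_Ici_self)
    have h5 : dt V x 0 = dx (dx V) x 0 := by
      refine tendsto_nhds_unique h4 (h3.congr' ?_)
      filter_upwards [self_mem_nhdsWithin] with t ht
      rw [hV.heat x t hx ht, add_zero]
    simp [robin, h1 x hx, h5, h2, hV.initial x hx]
  boundary := hV.boundary

/-- Integration by parts: `Re ∫ w̄ wₓₓ ≤ 0` for a function which vanishes at `x = 0`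
and at infinity. -/
lemma IsDirichletSolution.integral_inner_dt_nonpos {f : ℝ → ℂ}
    (hV : IsDirichletSolution (fun _ _ => 0) f (fun _ => 0) V) (hV' : IsAdmissible V)
    (ht : 0 < t) (hint : IntegrableOn (fun x => inner ℝ (V x t) (dt V x t)) (Ioi 0)) :
    ∫ x in Ioi 0, inner ℝ (V x t) (dt V x t) ≤ 0 := by
  have hV1 : IsCn 1 V := hV.smooth.of_le (by lia)
  have hVx : IsCn 1 (dx V) := hV.smooth.dx
  have hlim : Tendsto (fun R => inner ℝ (V R t) (dx V R t)) atTop (𝓝 0) := by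
    obtain ⟨K, hK⟩ := hV'.bounded_dx t ht
    have h0 : Tendsto (fun R => ‖V R t‖ * K) atTop (𝓝 0) := by
      simpa using (hV'.tendsto_zero t ht).norm.mul_const K
    refine squeeze_zero_norm' ?_ h0
    filter_upwards [eventually_ge_atTop 1] with R hR
    exact (norm_inner_le_norm _ _).trans
      (mul_le_mul_of_nonneg_left (hK R hR) (norm_nonneg _))
  refine le_of_tendsto_of_tendsto (intervalIntegral_tendsto_integral_Ioi 0 hint tendsto_id) hlim ?_
  filter_upwards [eventually_ge_atTop 0] with R hR
  have h := intervalIntegral.integral_le_sub_of_hasDeriv_right_of_le (a := 0) (b := R)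
    (g := fun x => inner ℝ (V x t) (dx V x t))
    (g' := fun x => inner ℝ (V x t) (dx (dx V) x t) + inner ℝ (dx V x t) (dx V x t))
    (φ := fun x => inner ℝ (V x t) (dt V x t)) hR
    (((hV1.continuousOn_horizontal ht).inner (hVx.continuousOn_horizontal ht)).mono
      Icc_subset_Ici_self)
    (fun x hx => ((hV1.hasDerivAt_dx hx.1 ht.le).inner ℝ
      (hVx.hasDerivAt_dx hx.1 ht.le)).hasDerivWithinAt)
    (((integrableOn_Ici_iff_integrableOn_Ioi (by simp)).2 hint).mono_set Icc_subset_Ici_self)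
    (fun x hx => by
      rw [hV.heat x t hx.1 ht, add_zero]
      exact le_add_of_nonneg_right real_inner_self_nonneg)
  simpa [hV.boundary t ht] using h

lemma norm_inner_le_of_sq_le {a b : ℂ} {M : ℝ} (ha : ‖a‖ ^ 2 ≤ M) (hb : ‖b‖ ^ 2 ≤ M) :
    ‖inner ℝ a b‖ ≤ M := by
  refine (norm_inner_le_norm a b).trans ?_
  nlinarith [sq_nonneg (‖a‖ - ‖b‖)]

/-- An admissible solution of the homogeneous Dirichlet problem vanishes, by the energy method. -/
theorem IsDirichletSolution.eq_zero
    (hV : IsDirichletSolution (fun _ _ => 0) (fun _ => 0) (fun _ => 0) V) (hV' : IsAdmissible V)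
    (h : (x, t) ∈ puncturedQuadrant) : V x t = 0 := by
  have hV1 : IsCn 1 V := hV.smooth.of_le (by lia)
  have hVt : IsCn 1 (dt V) := hV.smooth.dt
  have hmeas : ∀ t, 0 < t →
      AEStronglyMeasurable (fun x => ‖V x t‖ ^ 2) (volume.restrict (Ioi 0)) := fun t ht =>
    (((hV1.continuousOn_horizontal ht).mono Ioi_subset_Ici_self).norm.pow 2).aestronglyMeasurable
      measurableSet_Ioi
  have hmeas' : ∀ t, 0 < t → AEStronglyMeasurable (fun x => inner ℝ (V x t) (dt V x t))
      (volume.restrict (Ioi 0)) := fun t ht =>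
    (((hV1.continuousOn_horizontal ht).inner (hVt.continuousOn_horizontal ht)).mono
      Ioi_subset_Ici_self).aestronglyMeasurable measurableSet_Ioi
  have hint : ∀ t, 0 < t → IntegrableOn (fun x => ‖V x t‖ ^ 2) (Ioi 0) := fun t ht => by
    obtain ⟨M, hM, hb⟩ := hV'.dominated t ht
    refine hM.mono' (hmeas t ht) ((ae_restrict_iff' measurableSet_Ioi).2 (.of_forall fun x hx => ?_))
    simpa using (hb x t hx ht le_rfl).1
  have hint' : ∀ t, 0 < t → IntegrableOn (fun x => inner ℝ (V x t) (dt V x t)) (Ioi 0) :=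
    fun t ht => by
      obtain ⟨M, hM, hb⟩ := hV'.dominated t ht
      refine hM.mono' (hmeas' t ht)
        ((ae_restrict_iff' measurableSet_Ioi).2 (.of_forall fun x hx => ?_))
      exact norm_inner_le_of_sq_le (hb x t hx ht le_rfl).1 (hb x t hx ht le_rfl).2
  have hderiv : ∀ t, 0 < t → HasDerivAt (fun t => ∫ x in Ioi 0, ‖V x t‖ ^ 2)
      (∫ x in Ioi 0, 2 * inner ℝ (V x t) (dt V x t)) t := fun t ht => by
    obtain ⟨M, hM, hb⟩ := hV'.dominated (t + 1) (by linarith)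
    refine (hasDerivAt_integral_of_dominated_loc_of_deriv_le (s := Ioo 0 (t + 1))
      (F := fun t x => ‖V x t‖ ^ 2) (F' := fun t x => 2 * inner ℝ (V x t) (dt V x t))
      (bound := fun x => 2 * M x) (Ioo_mem_nhds ht (by linarith)) ?_ (hint t ht)
      ((hmeas' t ht).const_mul 2) ?_ (hM.const_mul 2) ?_).2
    · filter_upwards [Ioi_mem_nhds ht] with s hs using hmeas s hs
    · refine (ae_restrict_iff' measurableSet_Ioi).2 (.of_forall fun x hx s hs => ?_)
      rw [norm_mul, Real.norm_ofNat]
      have hb' := hb x s hx hs.1 hs.2.le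
      exact mul_le_mul_of_nonneg_left (norm_inner_le_of_sq_le hb'.1 hb'.2) zero_le_two
    · exact (ae_restrict_iff' measurableSet_Ioi).2 (.of_forall fun x hx s hs =>
        (hV1.hasDerivAt_dt (le_of_lt hx) hs.1).norm_sq)
  have hanti : AntitoneOn (fun t => ∫ x in Ioi 0, ‖V x t‖ ^ 2) (Ioi 0) := by
    refine antitoneOn_of_deriv_nonpos (convex_Ioi 0)
      (fun t ht => (hderiv t ht).continuousAt.continuousWithinAt) ?_ ?_
    · rw [interior_Ioi]
      exact fun t ht => (hderiv t ht).differentiableAt.differentiableWithinAt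
    · rw [interior_Ioi]
      intro t ht
      rw [(hderiv t ht).deriv, integral_const_mul]
      exact mul_nonpos_of_nonneg_of_nonpos zero_le_two
        (hV.integral_inner_dt_nonpos hV' ht (hint' t ht))
  have hlim : Tendsto (fun t => ∫ x in Ioi 0, ‖V x t‖ ^ 2) (𝓝[>] 0) (𝓝 0) := by
    obtain ⟨M, hM, hb⟩ := hV'.dominated 1 one_pos
    have := tendsto_integral_filter_of_dominated_convergence (μ := volume.restrict (Ioi 0))
      (l := 𝓝[>] (0 : ℝ)) (F := fun t x => ‖V x t‖ ^ 2) (f := fun _ => 0) M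
      (by filter_upwards [self_mem_nhdsWithin] with s hs using hmeas s hs)
      (by
        filter_upwards [Ioc_mem_nhdsGT one_pos] with s hs
        refine (ae_restrict_iff' measurableSet_Ioi).2 (.of_forall fun x hx => ?_)
        simpa using (hb x s hx hs.1 hs.2).1) hM
      ((ae_restrict_iff' measurableSet_Ioi).2 (.of_forall fun x hx => by
        have h1 := ((hV1.continuousOn_vertical hx) 0 self_mem_Ici).mono_left
          (nhdsWithin_mono _ Ioi_subset_Ici_self)
        simpa [hV.initial x hx] using h1.norm.pow 2))
    simpa using this
  have hpos : ∀ x t, 0 < x → 0 < t → V x t = 0 := fun x t hx ht => by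
    have hle : ∫ x in Ioi 0, ‖V x t‖ ^ 2 ≤ 0 := by
      refine ge_of_tendsto hlim ?_
      filter_upwards [Ioc_mem_nhdsGT ht] with s hs using hanti hs.1 ht hs.2
    have hz : ∫ x in Ioi 0, ‖V x t‖ ^ 2 = 0 :=
      le_antisymm hle (integral_nonneg fun x => by positivity)
    rw [setIntegral_eq_zero_iff_of_nonneg_ae (.of_forall fun x => by positivity)
      (hint t ht)] at hz
    have := Measure.eqOn_open_of_ae_eq hz isOpen_Ioi
      (((hV1.continuousOn_horizontal ht).mono Ioi_subset_Ici_self).norm.pow 2)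
      continuousOn_const hx
    simpa using this
  rcases h.1.eq_or_lt with h0 | hx
  · obtain rfl : 0 = x := h0
    exact hV.boundary t ((pos_or_pos_of_mem h).resolve_left (lt_irrefl _))
  · rcases h.2.1.eq_or_lt with h0 | ht
    · obtain rfl : 0 = t := h0
      exact hV.initial x hx
    · exact hpos x t hx ht

/-- A solution of `A V + B Vₓ + C Vₜ = 0` with zero initial values vanishes to the right of the
characteristic through the corner. -/
lemma eq_zero_of_robin_eq_zero {A B C : ℝ} (hB : 0 < B) (hC : 0 < C) (hV : IsCn 1 V)
    (hrobin : ∀ x t, (x, t) ∈ puncturedQuadrant → robin A B C V x t = 0)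
    (hinit : ∀ x, 0 < x → V x 0 = 0) (ht : 0 ≤ t) (hx : t * B / C < x) : V x t = 0 := by
  set a := x - t * B / C with ha
  have ha0 : 0 < a := sub_pos.2 hx
  have hmem : ∀ s, 0 ≤ s → (a + B * s, C * s) ∈ puncturedQuadrant := fun s hs =>
    mem_puncturedQuadrant_of_pos_left (by positivity) (by positivity)
  have hd : ∀ s, 0 ≤ s → HasDerivWithinAt (fun s : ℝ => V (a + B * s) (C * s))
      (-A * V (a + B * s) (C * s)) (Ici 0) s := fun s hs => by
    have hline : HasDerivWithinAt (fun s : ℝ => (a + B * s, C * s)) (B, C) (Ici 0) s := by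
      refine HasDerivWithinAt.prodMk ?_ ?_
      · simpa using ((hasDerivWithinAt_id s (Ici 0)).const_mul B).const_add a
      · simpa using (hasDerivWithinAt_id s (Ici 0)).const_mul C
    have hc := (hV.hasFDerivWithinAt (hmem s hs)).comp_hasDerivWithinAt s hline
      fun r hr => hmem r hr
    convert! hc using 1
    have hBC : ((B, C) : ℝ × ℝ) = B • (1, 0) + C • (0, 1) := by simp
    have hr := hrobin _ _ (hmem s hs)
    rw [robin, hV.dx_eq_fderivWithin (hmem s hs), hV.dt_eq_fderivWithin (hmem s hs)] at hr
    rw [hBC, map_add, map_smul, map_smul, Complex.real_smul, Complex.real_smul]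
    linear_combination -hr
  have hconst := constant_of_has_deriv_right_zero (a := 0) (b := t / C)
    (f := fun s : ℝ => Complex.exp (A * s) * V (a + B * s) (C * s)) ?_ ?_ (t / C)
    ⟨by positivity, le_rfl⟩
  · rw [mul_div_cancel₀ _ hC.ne', show a + B * (t / C) = x by rw [ha]; ring] at hconst
    simpa [hinit a ha0, Complex.exp_ne_zero] using hconst
  · refine ContinuousOn.mul (by fun_prop) fun s hs => ?_
    exact (hd s hs.1).continuousWithinAt.mono Icc_subset_Ici_self
  · intro s hs
    have he : HasDerivWithinAt (fun s : ℝ => Complex.exp (A * s)) (Complex.exp (A * s) * A)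
        (Ici s) s := by
      have h1 : HasDerivAt (fun s : ℝ => (A : ℂ) * s) A s := by
        simpa using (Complex.ofRealCLM.hasDerivAt (x := s)).const_mul (A : ℂ)
      exact h1.cexp.hasDerivWithinAt
    convert! he.mul ((hd s hs.1).mono (Ici_subset_Ici.2 hs.1)) using 1
    ring

/-- The vector field `(a, b) ↦ (b, p a + q b)` of a linear second order equation. -/
noncomputable def secondOrderField (p q : ℂ) : ℂ × ℂ →L[ℝ] ℂ × ℂ :=
  ((ContinuousLinearMap.snd ℂ ℂ ℂ).prod
    (p • ContinuousLinearMap.fst ℂ ℂ ℂ + q • ContinuousLinearMap.snd ℂ ℂ ℂ)).restrictScalars ℝ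

/-- A solution of the heat equation with zero initial values and vanishing oblique Robin expression
is zero: it vanishes for large `x`, and in `x` it solves a linear ordinary differential equation. -/
theorem eq_zero_of_heat_of_robin_eq_zero {A B C : ℝ} (hB : 0 < B) (hC : 0 < C) (hV : IsCn 2 V)
    (hheat : SolvesHeat (fun _ _ => 0) V)
    (hrobin : ∀ x t, (x, t) ∈ puncturedQuadrant → robin A B C V x t = 0)
    (hinit : ∀ x, 0 < x → V x 0 = 0) (h : (x, t) ∈ puncturedQuadrant) : V x t = 0 := by
  have hV1 : IsCn 1 V := hV.of_le (by lia)
  have hVx : IsCn 1 (dx V) := hV.dx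
  have hC' : (C : ℂ) ≠ 0 := by exact_mod_cast hC.ne'
  rcases h.2.1.eq_or_lt with h0 | ht
  · obtain rfl : 0 = t := h0
    exact hinit x ((pos_or_pos_of_mem h).resolve_right (lt_irrefl _))
  have hfar : ∀ y, t * B / C < y → V y t = 0 := fun y hy =>
    eq_zero_of_robin_eq_zero hB hC hV1 hrobin hinit ht.le hy
  have hr0 : 0 ≤ t * B / C := by positivity
  have hpos : ∀ y, 0 < y → V y t = 0 := fun y hy => by
    have hode : ∀ z, 0 < z → HasDerivAt (fun z => (V z t, dx V z t))
        (secondOrderField (-(A / C)) (-(B / C)) (V z t, dx V z t)) z := fun z hz => by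
      convert! (hV1.hasDerivAt_dx hz ht.le).prodMk (hVx.hasDerivAt_dx hz ht.le) using 1
      refine Prod.ext rfl ?_
      have h1 := hheat z t hz ht
      have h2 := hrobin z t (mem_puncturedQuadrant_of_pos_left hz ht.le)
      rw [robin] at h2
      simp only [secondOrderField, ContinuousLinearMap.coe_restrictScalars',
        ContinuousLinearMap.prod_apply, add_apply,
        smul_apply, ContinuousLinearMap.coe_fst', ContinuousLinearMap.coe_snd',
        smul_eq_mul]
      rw [← add_zero (dx (dx V) z t), ← h1]
      field_simp
      linear_combination -h2
    have := ODE_solution_unique_of_mem_Ioo (a := 0) (b := y + t * B / C + 2)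
      (t₀ := t * B / C + 1) (s := fun _ => univ)
      (v := fun _ => secondOrderField (-(A / C)) (-(B / C)))
      (f := fun z => (V z t, dx V z t)) (g := fun _ => 0)
      (fun _ _ => (secondOrderField (-(A / C)) (-(B / C))).lipschitz.lipschitzOnWith)
      ⟨by linarith, by linarith⟩ (fun z hz => ⟨hode z hz.1, mem_univ _⟩)
      (fun z _ => ⟨by simpa using hasDerivAt_const z (0 : ℂ × ℂ), mem_univ _⟩)
      (Prod.ext (hfar _ (by linarith)) (dx_eq_zero hfar (by linarith)))
      (show y ∈ Ioo 0 (y + t * B / C + 2) from ⟨hy, by linarith⟩)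
    exact (Prod.ext_iff.1 this).1
  rcases h.1.eq_or_lt with h0 | hx
  · obtain rfl : 0 = x := h0
    have hc : Tendsto (fun y => V y t) (𝓝[>] 0) (𝓝 (V 0 t)) :=
      ((hV1.continuousOn_horizontal ht) 0 self_mem_Ici).mono_left
        (nhdsWithin_mono _ Ioi_subset_Ici_self)
    refine tendsto_nhds_unique hc (tendsto_const_nhds.congr' ?_)
    filter_upwards [self_mem_nhdsWithin] with y hy using (hpos y hy).symm
  · exact hpos x hx

end QuarterPlane

theorem mainTheorem7 (A B C : ℝ) (hA : 0 < A) (hB : 0 < B) (hC : 0 < C)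
    (f : ℝ → ℝ → ℂ) (u₀ g₀ : ℝ → ℂ) (u v ξ w : ℝ → ℝ → ℂ)
    (hu : QuarterPlane.IsRobinSolution A B C f u₀ g₀ u)
    (hu' : QuarterPlane.IsAdmissible (QuarterPlane.robin A B C u))
    (hv : QuarterPlane.IsRobinSolution A B C f u₀ g₀ v)
    (hv' : QuarterPlane.IsAdmissible (QuarterPlane.robin A B C v))
    (hξ : ξ = fun x t => v x t - u x t)
    (hw : w = QuarterPlane.robin A B C ξ) :
    (QuarterPlane.IsDirichletSolution (fun _ _ => 0) (fun _ => 0) (fun _ => 0) w ∧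
      QuarterPlane.IsAdmissible w) ∧
    (∀ x t : ℝ, (x, t) ∈ QuarterPlane.puncturedQuadrant → w x t = 0) ∧
    (∀ x t : ℝ, (x, t) ∈ QuarterPlane.puncturedQuadrant → v x t = u x t) := by
  have hξ' : QuarterPlane.IsRobinSolution A B C (fun _ _ => 0) (fun _ => 0) (fun _ => 0) ξ :=
    hξ ▸ hv.sub hu
  have hD : QuarterPlane.IsDirichletSolution (fun _ _ => 0) (fun _ => 0) (fun _ => 0) w :=
    hw ▸ hξ'.isDirichletSolution_robin
  have hadm : QuarterPlane.IsAdmissible w := by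
    refine (hv'.sub hu' (QuarterPlane.IsCn.robin A B C (hv.smooth.of_le (by lia)))
      (QuarterPlane.IsCn.robin A B C (hu.smooth.of_le (by lia)))).congr fun x t hx ht => ?_
    rw [hw, hξ]
    exact QuarterPlane.robin_sub A B C (hv.smooth.of_le (by lia)) (hu.smooth.of_le (by lia))
      (QuarterPlane.mem_puncturedQuadrant_of_pos_left hx ht.le)
  have hw0 : ∀ x t : ℝ, (x, t) ∈ QuarterPlane.puncturedQuadrant → w x t = 0 :=
    fun x t h => hD.eq_zero hadm h
  refine ⟨⟨hD, hadm⟩, hw0, fun x t h => sub_eq_zero.1 ?_⟩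
  have := QuarterPlane.eq_zero_of_heat_of_robin_eq_zero hB hC (hξ'.smooth.of_le (by lia))
    hξ'.heat (hw ▸ hw0) hξ'.initial h
  rwa [hξ] at this
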